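/- Let $L\ge 1$, $\mathcal L=\{0,\dots,L\}$, let $\mathcal X$ be a measurable space, let $\mathcal G$ be a class of measurable classifiers $g:\mathcal X\to\mathcal L$, and let $\mathbf P=(P_0,\dots,P_L)$ be probability measures on $\mathcal X$. Write $p_{\vartheta,m}(g)=P_\vartheta(g(X)=m)$, and call $g\in\mathcal G$ a \emph{separable classifier} for $\mathbf P$ if $p_{\vartheta,\vartheta}(g)>\max_{m\ne\vartheta}p_{\vartheta,m}(g)$ for every $\vartheta\in\mathcal L$. Let $\mathcal P_{\mathrm{sep}}$ be the set of all $\mathbf P$ that have a separable classifier in $\mathcal G$. For $m\in\mathcal L$ let $F_m=\{x\mapsto \mathbf 1\{g(x)=m\}: g\in\mathcal G\}$. Assume $\mathrm{VCdim}(F_m)\le d$ for every $m\in\mathcal L$, where $d\ge 0$ is an integer ($0^0=1$). Assume moreover the usual measurability of the class on finite samples: for all $\vartheta,m\in\mathcal L$, $n\in\mathbb N$ and $S\subseteq\{1,\dots,n\}$, the set $\{x\in\mathcal X^n:\ \exists g\in\mathcal G\ \forall i,\ g(x_i)=m\iff i\in S\}$ is measurable up to $P_\vartheta^{\otimes n}$-null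 sets. Let $\mathbf P\in\mathcal P_{\mathrm{sep}}$. Then there is $g^*\in\mathcal G$ with $$\Delta^*:=\min_{\vartheta\in\mathcal L}\min_{m\ne\vartheta}\bigl(p_{\vartheta,\vartheta}(g^*)-p_{\vartheta,m}(g^*)\bigr)>0 .$$ For every such $g^*$, put $\gamma=\Delta^*/8$, let $\delta\in(0,1)$, and let $N\in\mathbb N$ satisfy $$N\ \ge\ \max\Bigl\{d,\ \frac{8}{\gamma^2}\log\frac{(L+1)^2\cdot 4\,(2eN)^d/d^d}{\delta}\Bigr\}.$$ For each $\vartheta\in\mathcal L$ let $T_{\vartheta,1},\dots,T_{\vartheta,N}$ be i.i.d. with law $P_\vartheta$, all defined on one probability space, and let $$\hat p_{\vartheta,m}(g)=\frac1N\sum_{i=1}^N\mathbf 1\{g(T_{\vartheta,i})=m\},\qquad \hat\Delta(g)=\min_{\vartheta\in\mathcal L}\min_{m\ne\vartheta}\bigl(\hat p_{\vartheta,\vartheta}(g)-\hat p_{\vartheta,m}(g)\bigr).$$ Then $\hat\Delta$ attains its maximum over $\mathcal G$, and with probability at least $1-\delta$ every maximizer $\hat g\in\arg\max_{g\in\mathcal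 G}\hat\Delta(g)$ is a separable classifier for $\mathbf P$, i.e. $p_{\vartheta,\vartheta}(\hat g)>\max_{m\ne\vartheta}p_{\vartheta,m}(\hat g)$ for all $\vartheta\in\mathcal L$. (Precisely: there is an event of probability at least $1-\delta$ on which this holds.) -/

import Mathlib

open MeasureTheory ProbabilityTheory

noncomputable section

namespace EmpSep

/-- A family `F` of subsets of `X` (equivalently, of `{0,1}`-valued functions on `X`) shatters the
finite set `s` if every subset of `s` is cut out of `s` by a member of `F`. -/
def Shatters {X : Type*} (F : Set (Set X)) (s : Finset X) : Prop :=
  ∀ t : Set X, t ⊆ s → ∃ A ∈ F, (s : Set X) ∩ A = t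

/-- The VC dimension: the supremum of the cardinalities of the finite sets that are shattered. -/
def vcDim {X : Type*} (F : Set (Set X)) : ℕ∞ :=
  ⨆ (s : Finset X) (_ : Shatters F s), (s.card : ℕ∞)

/-- The measurability convention for a family `F` of sets and a law `ν`: whether some member of `F`
selects exactly the points with index in `S` out of a sample of `n` points is an event
(measurable up to null sets) for the law `ν ^ n` of an i.i.d. sample. -/
def SampleMeasurable {X : Type*} [MeasurableSpace X] (F : Set (Set X)) (ν : Measure X) : Prop :=
  ∀ (n : ℕ) (S : Set (Fin n)),
    NullMeasurableSet {x : Fin n → X | ∃ A ∈ F, ∀ i, x i ∈ A ↔ i ∈ S} (Measure.pi fun _ => ν)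

variable {X : Type*} {L : ℕ}

/-- The class `F_m` of the indicators of `g(x) = m`, for `g ∈ G`; an indicator is represented by the
set on which it equals one. -/
def labelClass (G : Set (X → Fin (L + 1))) (m : Fin (L + 1)) : Set (Set X) :=
  {A | ∃ g ∈ G, A = {x | g x = m}}

/-- The gap `min_ϑ min_{m ≠ ϑ} (q ϑ ϑ - q ϑ m)` of a matrix `q`. (It is only used for `1 ≤ L`, where
these are infima over nonempty finite sets.) -/
def gap (q : Fin (L + 1) → Fin (L + 1) → ℝ) : ℝ :=
  ⨅ ϑ : Fin (L + 1), ⨅ m : {m : Fin (L + 1) // m ≠ ϑ}, (q ϑ ϑ - q ϑ m)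

/-- The empirical confusion probability, the fraction of the `N` samples `t ϑ 0, …, t ϑ (N - 1)` with
label `ϑ` that `g` classifies as `m`. -/
def empConf {N : ℕ} (t : Fin (L + 1) → Fin N → X) (g : X → Fin (L + 1))
    (ϑ m : Fin (L + 1)) : ℝ :=
  (1 / (N : ℝ)) * ∑ i : Fin N, if g (t ϑ i) = m then (1 : ℝ) else 0

/-- The set of maximizers over `G` of the empirical gap for the training data `t`. -/
def empGapArgmax {N : ℕ} (G : Set (X → Fin (L + 1))) (t : Fin (L + 1) → Fin N → X) :
    Set (X → Fin (L + 1)) :=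
  {g | g ∈ G ∧ ∀ h ∈ G, gap (empConf t h) ≤ gap (empConf t g)}

variable [MeasurableSpace X]

/-- The confusion probability `P_ϑ(g(X) = m)`. -/
def conf (P : Fin (L + 1) → ProbabilityMeasure X) (g : X → Fin (L + 1))
    (ϑ m : Fin (L + 1)) : ℝ :=
  (P ϑ : Measure X).real {x | g x = m}

/-- `g` is a separable classifier for the tuple `P`. -/
def IsSeparableClassifier (P : Fin (L + 1) → ProbabilityMeasure X) (g : X → Fin (L + 1)) : Prop :=
  ∀ ϑ m : Fin (L + 1), m ≠ ϑ → conf P g ϑ m < conf P g ϑ ϑ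

/-- The tuples of distributions that are distinguishable by the hypothesis class `G`. -/
def Psep (G : Set (X → Fin (L + 1))) : Set (Fin (L + 1) → ProbabilityMeasure X) :=
  {P | ∃ g ∈ G, IsSeparableClassifier P g}

end EmpSep

end

/-!
Vapnik–Chervonenkis: a deviation of size `ε` of an empirical frequency from its probability is
compared with a deviation of size `ε / 2` from the frequency in an independent ghost sample. The law
of the double sample is invariant under exchanging `x i` with the ghost point `y i` at randomly
chosen indices `i`. For a fixed double sample the random exchanges turn the difference of
frequencies into an average of independent signs, controlled by Hoeffding's inequality, and by the
Sauer–Shelah lemma a union bound over polynomially many sets suffices.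

The gap moves by at most `2 ε` when every confusion probability moves by at most `ε`. Thus, if all
empirical confusion probabilities are `ε`-accurate with `4 ε < Δ*`, a maximizer of the empirical
gap has true gap at least `Δ* - 4 ε > 0`; here `ε = γ = Δ* / 8`.
-/

namespace EmpSep

section Hoeffding

variable {Ω ι : Type*} [MeasurableSpace Ω] [Fintype ι] {μ : Measure Ω}

theorem measureReal_le_abs_sum_of_iIndepFun {Y : ι → Ω → ℝ} {c : ι → NNReal}
    (hindep : iIndepFun Y μ) (hY : ∀ i, HasSubgaussianMGF (Y i) (c i) μ) {ε : ℝ} (hε : 0 ≤ ε) :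
    μ.real {ω | ε ≤ |∑ i, Y i ω|} ≤ 2 * Real.exp (-ε ^ 2 / (2 * ∑ i, c i)) := by
  have := hindep.isProbabilityMeasure
  have hneg : iIndepFun (fun i ω => -Y i ω) μ :=
    hindep.comp (fun _ => Neg.neg) fun _ => measurable_neg
  have hupper := HasSubgaussianMGF.measure_sum_ge_le_of_iIndepFun hindep
    (s := Finset.univ) (fun i _ => hY i) hε
  have hlower := HasSubgaussianMGF.measure_sum_ge_le_of_iIndepFun hneg
    (s := Finset.univ) (fun i _ => (hY i).neg) hε
  have hsplit : {ω | ε ≤ |∑ i, Y i ω|} = {ω | ε ≤ ∑ i, Y i ω} ∪ {ω | ε ≤ ∑ i, -Y i ω} := by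
    ext ω
    simp [le_abs]
  rw [hsplit, two_mul]
  refine (measureReal_union_le _ _).trans (add_le_add ?_ ?_)
  · simpa using hupper
  · simpa using hlower

theorem measureReal_le_abs_average_sub_integral {Y : ι → Ω → ℝ} (hindep : iIndepFun Y μ)
    (hY : ∀ i, AEMeasurable (Y i) μ) {a b : ℝ} (hab : ∀ i, ∀ᵐ ω ∂μ, Y i ω ∈ Set.Icc a b)
    {ε : ℝ} (hε : 0 ≤ ε) :
    μ.real {ω | ε ≤ |(∑ i, (Y i ω - μ[Y i])) / Fintype.card ι|} ≤
      2 * Real.exp (-(2 * Fintype.card ι * ε ^ 2 / (b - a) ^ 2)) := by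
  have := hindep.isProbabilityMeasure
  rcases isEmpty_or_nonempty ι with _ | _
  · simpa using measureReal_le_one.trans one_le_two
  have hn : (0 : ℝ) < Fintype.card ι := by exact_mod_cast Fintype.card_pos
  have hcentered : iIndepFun (fun i ω => Y i ω - μ[Y i]) μ :=
    hindep.comp (fun i y => y - ∫ ω, Y i ω ∂μ) fun _ => measurable_id.sub_const _
  have h := measureReal_le_abs_sum_of_iIndepFun hcentered
    (fun i => hasSubgaussianMGF_of_mem_Icc (hY i) (hab i)) (mul_nonneg hn.le hε)
  simp only [abs_div, Nat.abs_cast, le_div_iff₀' hn]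
  convert h using 3
  simp only [Finset.sum_const, Finset.card_univ, nsmul_eq_mul]
  push_cast
  rw [Real.norm_eq_abs, div_pow, sq_abs]
  rcases eq_or_ne (b - a) 0 with h0 | h0
  · simp [h0]
  · field_simp

end Hoeffding

section AveragingPrinciples

variable {α β : Type*} [MeasurableSpace α] [MeasurableSpace β]

theorem mul_measure_le_prod_of_forall_le_section (μ : Measure α) (ν : Measure β) [SFinite ν]
    {s : Set α} {t : Set (α × β)} {c : ENNReal} (h : ∀ x ∈ s, c ≤ ν (Prod.mk x ⁻¹' t)) :
    c * μ s ≤ (μ.prod ν) t := by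
  set t' := toMeasurable (μ.prod ν) t
  have ht' : MeasurableSet t' := measurableSet_toMeasurable _ _
  calc c * μ s ≤ c * μ {x | c ≤ ν (Prod.mk x ⁻¹' t')} := by
        gcongr
        exact fun x hx => (h x hx).trans
          (measure_mono (Set.preimage_mono (subset_toMeasurable _ _)))
    _ ≤ ∫⁻ x, ν (Prod.mk x ⁻¹' t') ∂μ :=
        mul_meas_ge_le_lintegral (measurable_measure_prodMk_left ht') c
    _ = (μ.prod ν) t := by rw [← Measure.prod_apply ht', measure_toMeasurable]

theorem measure_le_of_forall_measure_randomized_le [Countable β] [MeasurableSingletonClass β]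
    {μ : Measure α} [IsProbabilityMeasure μ] (ρ : Measure β) [IsProbabilityMeasure ρ]
    {τ : β → α → α} (hτ : ∀ b, MeasurePreserving (τ b) μ μ) {s : Set α}
    (hs : NullMeasurableSet s μ) {c : ENNReal} (h : ∀ x, ρ {b | τ b x ∈ s} ≤ c) : μ s ≤ c := by
  have hpre (b : β) : NullMeasurableSet (τ b ⁻¹' s) μ := hs.preimage (hτ b).quasiMeasurePreserving
  calc μ s = ∑' b, ρ {b} * μ (τ b ⁻¹' s) := by
        have hρ : ∑' b, ρ {b} = 1 := by
          simpa using ρ.tsum_indicator_apply_singleton Set.univ .univ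
        simp_rw [(hτ _).measure_preimage hs, ENNReal.tsum_mul_right, hρ, one_mul]
    _ = ∑' b, ∫⁻ x, (τ b ⁻¹' s).indicator (fun _ => ρ {b}) x ∂μ := by
        simp_rw [lintegral_indicator_const₀ (hpre _)]
    _ = ∫⁻ x, ∑' b, (τ b ⁻¹' s).indicator (fun _ => ρ {b}) x ∂μ :=
        (lintegral_tsum fun b => aemeasurable_const.indicator₀ (hpre b)).symm
    _ = ∫⁻ x, ρ {b | τ b x ∈ s} ∂μ := by
        refine lintegral_congr fun x => ?_
        exact ρ.tsum_indicator_apply_singleton _ (Set.to_countable _).measurableSet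
    _ ≤ ∫⁻ _, c ∂μ := lintegral_mono h
    _ = c := by simp

theorem exists_measurableSet_one_sub_le_measureReal {μ : Measure α} [IsProbabilityMeasure μ]
    {s : Set α} {δ : ℝ} (h : μ.real s ≤ δ) :
    ∃ t, MeasurableSet t ∧ 1 - δ ≤ μ.real t ∧ Disjoint t s := by
  refine ⟨(toMeasurable μ s)ᶜ, (measurableSet_toMeasurable μ s).compl, ?_,
    disjoint_compl_left.mono_right (subset_toMeasurable μ s)⟩
  rw [probReal_compl_eq_one_sub (measurableSet_toMeasurable μ s), measureReal_def,
    measure_toMeasurable]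
  exact sub_le_sub_left h 1

end AveragingPrinciples

section GrowthFunction

theorem sum_Iic_choose_le {n d : ℕ} (hdn : d ≤ n) :
    ((∑ k ∈ Finset.Iic d, n.choose k : ℕ) : ℝ) ≤ (Real.exp 1 * n) ^ d / (d : ℝ) ^ d := by
  rcases Nat.eq_zero_or_pos d with rfl | hd
  · simp [show Finset.Iic 0 = {0} from rfl]
  have hd' : (0 : ℝ) < d := by exact_mod_cast hd
  have hn : (0 : ℝ) < n := by exact_mod_cast hd.trans_le hdn
  set r : ℝ := d / n
  have hr : 0 < r := div_pos hd' hn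
  have hr1 : r ≤ 1 := (div_le_one hn).2 (by exact_mod_cast hdn)
  have hweighted : ((∑ k ∈ Finset.Iic d, n.choose k : ℕ) : ℝ) * r ^ d ≤ Real.exp 1 ^ d := by
    calc ((∑ k ∈ Finset.Iic d, n.choose k : ℕ) : ℝ) * r ^ d
        = ∑ k ∈ Finset.Iic d, r ^ d * n.choose k := by
          rw [Nat.cast_sum, Finset.sum_mul]
          simp only [mul_comm]
      _ ≤ ∑ k ∈ Finset.Iic d, r ^ k * n.choose k := by
          refine Finset.sum_le_sum fun k hk => mul_le_mul_of_nonneg_right ?_ (Nat.cast_nonneg _)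
          exact pow_le_pow_of_le_one hr.le hr1 (Finset.mem_Iic.1 hk)
      _ ≤ ∑ k ∈ Finset.range (n + 1), r ^ k * n.choose k := by
          gcongr
          intro k hk
          exact Finset.mem_range_succ_iff.2 ((Finset.mem_Iic.1 hk).trans hdn)
      _ = (r + 1) ^ n := by simp [add_pow]
      _ ≤ Real.exp r ^ n := by
          gcongr
          exact Real.add_one_le_exp r
      _ = Real.exp 1 ^ d := by
          rw [← Real.exp_nat_mul, ← Real.exp_nat_mul, mul_div_cancel₀ _ hn.ne', mul_one]
  calc ((∑ k ∈ Finset.Iic d, n.choose k : ℕ) : ℝ) ≤ Real.exp 1 ^ d / r ^ d :=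
        (le_div_iff₀ (pow_pos hr d)).2 hweighted
    _ = (Real.exp 1 * n) ^ d / (d : ℝ) ^ d := by
        rw [← div_pow, ← div_pow, div_div_eq_mul_div]

variable {X ι : Type*} {F : Set (Set X)}

theorem Shatters.card_le {s : Finset X} (hs : Shatters F s) {d : ℕ} (hF : vcDim F ≤ d) :
    s.card ≤ d := by
  exact_mod_cast (le_iSup₂ (f := fun (s : Finset X) (_ : Shatters F s) => (s.card : ℕ∞))
    s hs).trans hF

variable [Fintype ι]

open Classical in
/-- The trace of a family of sets on a sample: the sets of indices at which the sample points
belong to a common member of the family. -/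
noncomputable def trace (F : Set (Set X)) (z : ι → X) : Finset (Finset ι) :=
  {S | ∃ A ∈ F, z ⁻¹' A = S}

theorem mem_trace {z : ι → X} {S : Finset ι} : S ∈ trace F z ↔ ∃ A ∈ F, z ⁻¹' A = S := by
  simp [trace]

theorem injOn_of_shatters_trace [DecidableEq ι] {z : ι → X} {s : Finset ι}
    (hs : (trace F z).Shatters s) : Set.InjOn z s := by
  intro i hi j hj hij
  obtain ⟨S, hS, hSi⟩ := hs (Finset.singleton_subset_iff.2 hi)
  obtain ⟨A, -, hA⟩ := mem_trace.1 hS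
  have hmem (k : ι) (hk : k ∈ s) : z k ∈ A ↔ k = i := by
    rw [← Set.mem_preimage, hA, ← Finset.mem_singleton, ← hSi]
    simp [hk]
  exact ((hmem j hj).1 (hij ▸ (hmem i hi).2 rfl)).symm

theorem Shatters.image_of_trace [DecidableEq ι] [DecidableEq X] {z : ι → X} {s : Finset ι}
    (hs : (trace F z).Shatters s) : Shatters F (s.image z) := by
  classical
  intro t ht
  obtain ⟨S, hS, hSt⟩ := hs (Finset.filter_subset (fun i => z i ∈ t) s)
  obtain ⟨A, hAF, hA⟩ := mem_trace.1 hS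
  have hmem (i : ι) (hi : i ∈ s) : z i ∈ A ↔ z i ∈ t := by
    rw [← Set.mem_preimage, hA]
    simpa [hi] using Finset.ext_iff.1 hSt i
  refine ⟨A, hAF, Set.Subset.antisymm ?_ fun x hx => ⟨ht hx, ?_⟩⟩
  · rintro x ⟨hx, hxA⟩
    obtain ⟨i, hi, rfl⟩ := Finset.mem_image.1 hx
    exact (hmem i hi).1 hxA
  · obtain ⟨i, hi, rfl⟩ := Finset.mem_image.1 (ht hx)
    exact (hmem i hi).2 hx

theorem vcDim_trace_le [DecidableEq ι] {d : ℕ} (hF : vcDim F ≤ d) (z : ι → X) :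
    (trace F z).vcDim ≤ d := by
  classical
  refine Finset.sup_le fun s hs => ?_
  rw [Finset.mem_shatterer] at hs
  rw [← Finset.card_image_of_injOn (injOn_of_shatters_trace hs)]
  exact (Shatters.image_of_trace hs).card_le hF

theorem card_trace_le {d : ℕ} (hF : vcDim F ≤ d) (hd : d ≤ Fintype.card ι) (z : ι → X) :
    ((trace F z).card : ℝ) ≤ (Real.exp 1 * Fintype.card ι) ^ d / (d : ℝ) ^ d := by
  classical
  refine le_trans (Nat.cast_le.2 ?_) (sum_Iic_choose_le hd)
  calc (trace F z).card ≤ (trace F z).shatterer.card := Finset.card_le_card_shatterer _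
    _ ≤ ∑ k ∈ Finset.Iic (trace F z).vcDim, (Fintype.card ι).choose k :=
        Finset.card_shatterer_le_sum_vcDim
    _ ≤ ∑ k ∈ Finset.Iic d, (Fintype.card ι).choose k :=
        Finset.sum_le_sum_of_subset (Finset.Iic_subset_Iic.2 (vcDim_trace_le hF z))

end GrowthFunction

section EmpiricalFrequency

variable {X ι : Type*}

/-- The permutation of the indices of a double sample that exchanges its halves at the indices
where `σ` is true. -/
def swapAt (σ : ι → Bool) : Equiv.Perm (ι ⊕ ι) :=
  Function.Involutive.toPerm
    (Sum.elim (fun i => bif σ i then Sum.inr i else Sum.inl i)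
      (fun i => bif σ i then Sum.inl i else Sum.inr i))
    (by rintro (i | i) <;> cases h : σ i <;> simp [h])

@[simp]
theorem swapAt_inl (σ : ι → Bool) (i : ι) :
    swapAt σ (Sum.inl i) = bif σ i then Sum.inr i else Sum.inl i := rfl

@[simp]
theorem swapAt_inr (σ : ι → Bool) (i : ι) :
    swapAt σ (Sum.inr i) = bif σ i then Sum.inl i else Sum.inr i := rfl

variable [Fintype ι]

/-- The fraction of the points of the sample `x` that lie in `A` (`0` for the empty sample). -/
noncomputable def empFreq (A : Set X) (x : ι → X) : ℝ :=
  (∑ i, A.indicator 1 (x i)) / Fintype.card ι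

/-- The difference of the frequencies of `A` in the two halves of the double sample `z`. -/
noncomputable def halfDiff (A : Set X) (z : ι ⊕ ι → X) : ℝ :=
  empFreq A (z ∘ Sum.inl) - empFreq A (z ∘ Sum.inr)

/-- The samples on which the frequency of some `A ∈ F` is off by at least `ε` from its probability
under `ν`. -/
def deviationSet [MeasurableSpace X] (F : Set (Set X)) (ν : Measure X)
    (ε : ℝ) : Set (ι → X) :=
  {x | ∃ A ∈ F, ε ≤ |empFreq A x - ν.real A|}

/-- The double samples on whose two halves the frequencies of some `A ∈ F` differ by at least `ε`;
the second half is the ghost sample of the symmetrization argument. -/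
def ghostDeviationSet (F : Set (Set X)) (ε : ℝ) : Set (ι ⊕ ι → X) :=
  {z | ∃ A ∈ F, ε ≤ |halfDiff A z|}

theorem halfDiff_comp (A : Set X) (z : ι ⊕ ι → X) (e : ι ⊕ ι → ι ⊕ ι) :
    halfDiff A (z ∘ e) = halfDiff (z ⁻¹' A) e := rfl

theorem halfDiff_swapAt (A : Set (ι ⊕ ι)) (σ : ι → Bool) :
    halfDiff A (swapAt σ) = (∑ i, (bif σ i then -1 else 1) *
      (A.indicator 1 (Sum.inl i) - A.indicator 1 (Sum.inr i))) / Fintype.card ι := by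
  rw [halfDiff, empFreq, empFreq, ← sub_div, ← Finset.sum_sub_distrib]
  congr! 2 with i
  cases h : σ i <;> simp [h]

theorem mem_ghostDeviationSet_comp {F : Set (Set X)} {ε : ℝ} {z : ι ⊕ ι → X}
    (e : ι ⊕ ι → ι ⊕ ι) : z ∘ e ∈ ghostDeviationSet F ε ↔
      ∃ S ∈ trace F z, ε ≤ |halfDiff (S : Set (ι ⊕ ι)) e| := by
  classical
  constructor
  · rintro ⟨A, hA, hε⟩
    exact ⟨(z ⁻¹' A).toFinset, mem_trace.2 ⟨A, hA, by simp⟩, by simpa [halfDiff_comp] using hε⟩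
  · rintro ⟨S, hS, hε⟩
    obtain ⟨A, hA, hAS⟩ := mem_trace.1 hS
    exact ⟨A, hA, by rwa [halfDiff_comp, hAS]⟩

end EmpiricalFrequency

section FairCoins

variable {X : Type*} (ι : Type*) [Fintype ι]

/-- The uniform distribution on `ι → Bool`, as a product of fair coins. -/
noncomputable def fairCoins : Measure (ι → Bool) :=
  Measure.pi fun _ => (PMF.uniformOfFintype Bool).toMeasure

instance : IsProbabilityMeasure (fairCoins ι) := by
  unfold fairCoins
  infer_instance

variable {ι}

theorem fairCoins_le_abs_signed_average {c : ι → ℝ} (hc : ∀ i, |c i| ≤ 1) {ε : ℝ} (hε : 0 ≤ ε) :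
    (fairCoins ι).real {σ | ε ≤ |(∑ i, (bif σ i then -1 else 1) * c i) / Fintype.card ι|} ≤
      2 * Real.exp (-(Fintype.card ι * ε ^ 2 / 2)) := by
  set Y : ι → Bool → ℝ := fun i b => (bif b then -1 else 1) * c i
  have hindep : iIndepFun (fun i (σ : ι → Bool) => Y i (σ i)) (fairCoins ι) :=
    iIndepFun_pi fun i => (measurable_of_finite (Y i)).aemeasurable
  have hbound (i : ι) (b : Bool) : Y i b ∈ Set.Icc (-1 : ℝ) 1 := by
    refine abs_le.1 ?_
    cases b <;> simpa [Y] using hc i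
  have hmean (i : ι) : ∫ σ, Y i (σ i) ∂fairCoins ι = 0 := by
    rw [fairCoins, integral_comp_eval (μ := fun _ : ι => (PMF.uniformOfFintype Bool).toMeasure)
      (measurable_of_finite (Y i)).aestronglyMeasurable, PMF.integral_eq_sum]
    simp [Y]
  have h := measureReal_le_abs_average_sub_integral hindep
    (fun i => (measurable_of_finite _).aemeasurable) (fun i => ae_of_all _ fun σ => hbound i (σ i))
    hε
  simp only [hmean, sub_zero] at h
  convert h using 3
  ring

theorem fairCoins_swapAt_mem_ghostDeviationSet_le {F : Set (Set X)} {d : ℕ} (hF : vcDim F ≤ d)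
    (hd : d ≤ 2 * Fintype.card ι) {ε : ℝ} (hε : 0 ≤ ε) (z : ι ⊕ ι → X) :
    (fairCoins ι).real {σ | z ∘ swapAt σ ∈ ghostDeviationSet F ε} ≤
      (2 * Real.exp 1 * Fintype.card ι) ^ d / (d : ℝ) ^ d *
        (2 * Real.exp (-(Fintype.card ι * ε ^ 2 / 2))) := by
  set p := 2 * Real.exp (-(Fintype.card ι * ε ^ 2 / 2))
  have hfixed (S : Finset (ι ⊕ ι)) :
      (fairCoins ι).real {σ | ε ≤ |halfDiff (S : Set (ι ⊕ ι)) (swapAt σ)|} ≤ p := by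
    simp only [halfDiff_swapAt]
    refine fairCoins_le_abs_signed_average (fun i => ?_) hε
    classical
    simp only [Set.indicator_apply, Pi.one_apply]
    split_ifs <;> simp
  have hunion : {σ | z ∘ swapAt σ ∈ ghostDeviationSet F ε} =
      ⋃ S ∈ trace F z, {σ | ε ≤ |halfDiff (S : Set (ι ⊕ ι)) (swapAt σ)|} := by
    ext σ
    simp only [mem_ghostDeviationSet_comp, Set.mem_ofPred_eq, Set.mem_iUnion, exists_prop]
  have hcard := card_trace_le hF (by rwa [Fintype.card_sum, ← two_mul]) z
  calc (fairCoins ι).real {σ | z ∘ swapAt σ ∈ ghostDeviationSet F ε}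
      ≤ ∑ S ∈ trace F z,
          (fairCoins ι).real {σ | ε ≤ |halfDiff (S : Set (ι ⊕ ι)) (swapAt σ)|} := by
        rw [hunion]
        exact measureReal_biUnion_finset_le _ _
    _ ≤ (trace F z).card * p := by
        simpa using Finset.sum_le_card_nsmul (trace F z) _ p fun S _ => hfixed S
    _ ≤ (2 * Real.exp 1 * Fintype.card ι) ^ d / (d : ℝ) ^ d * p := by
        rw [Fintype.card_sum, Nat.cast_add, ← two_mul, mul_left_comm, ← mul_assoc] at hcard
        exact mul_le_mul_of_nonneg_right hcard (by positivity)

end FairCoins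

section Exchangeability

variable {X ι : Type*} [MeasurableSpace X] [Fintype ι] {F : Set (Set X)} {ν : Measure X}
  [SigmaFinite ν]

theorem measurePreserving_comp_equiv {κ : Type*} [Fintype κ] (e : κ ≃ ι) :
    MeasurePreserving (fun z : ι → X => z ∘ e) (Measure.pi fun _ => ν) (Measure.pi fun _ => ν) :=
  measurePreserving_arrowCongr' (fun _ => ν) (fun _ => ν) e.symm (MeasurableEquiv.refl X)
    fun _ => MeasurePreserving.id ν

theorem SampleMeasurable.nullMeasurableSet_mem_trace (hF : SampleMeasurable F ν) (S : Finset ι) :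
    NullMeasurableSet {z : ι → X | S ∈ trace F z} (Measure.pi fun _ => ν) := by
  let e := Fintype.equivFin ι
  convert! (hF (Fintype.card ι) (e.symm ⁻¹' S)).preimage
    (measurePreserving_comp_equiv e.symm).quasiMeasurePreserving using 1
  ext z
  simp only [mem_trace, Set.mem_ofPred_eq, Set.mem_preimage, Function.comp_apply, Set.ext_iff,
    e.symm.surjective.forall]

theorem SampleMeasurable.nullMeasurableSet_ghostDeviationSet (hF : SampleMeasurable F ν) (ε : ℝ) :
    NullMeasurableSet (ghostDeviationSet F ε : Set (ι ⊕ ι → X)) (Measure.pi fun _ => ν) := by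
  have hunion : (ghostDeviationSet F ε : Set (ι ⊕ ι → X)) =
      ⋃ S ∈ {S : Finset (ι ⊕ ι) | ε ≤ |halfDiff (S : Set (ι ⊕ ι)) id|}, {z | S ∈ trace F z} := by
    ext z
    rw [← Function.comp_id z, mem_ghostDeviationSet_comp]
    simp [and_comm]
  rw [hunion]
  exact .biUnion (Set.to_countable _) fun S _ => hF.nullMeasurableSet_mem_trace S

end Exchangeability

section VapnikChervonenkis

variable {X ι : Type*} [MeasurableSpace X] [Fintype ι] {F : Set (Set X)} {ν : Measure X}
  [IsProbabilityMeasure ν]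

theorem pi_ghostDeviationSet_le (hmeas : SampleMeasurable F ν) {d : ℕ} (hF : vcDim F ≤ d)
    (hd : d ≤ 2 * Fintype.card ι) {ε : ℝ} (hε : 0 ≤ ε) :
    (Measure.pi fun _ => ν).real (ghostDeviationSet F ε : Set (ι ⊕ ι → X)) ≤
      (2 * Real.exp 1 * Fintype.card ι) ^ d / (d : ℝ) ^ d *
        (2 * Real.exp (-(Fintype.card ι * ε ^ 2 / 2))) := by
  refine ENNReal.toReal_le_of_le_ofReal (by positivity) ?_
  refine measure_le_of_forall_measure_randomized_le (fairCoins ι)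
    (fun σ => measurePreserving_comp_equiv (swapAt σ))
    (hmeas.nullMeasurableSet_ghostDeviationSet ε) fun z => ?_
  rw [← ofReal_measureReal]
  exact ENNReal.ofReal_le_ofReal (fairCoins_swapAt_mem_ghostDeviationSet_le hF hd hε z)

theorem pi_le_abs_empFreq_sub_measureReal {A : Set X} (hA : MeasurableSet A) {ε : ℝ} (hε : 0 ≤ ε) :
    (Measure.pi fun _ : ι => ν).real {x | ε ≤ |empFreq A x - ν.real A|} ≤
      2 * Real.exp (-(2 * Fintype.card ι * ε ^ 2)) := by
  rcases isEmpty_or_nonempty ι with _ | _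
  · simpa using measureReal_le_one.trans one_le_two
  have hind : Measurable (A.indicator (1 : X → ℝ)) := measurable_one.indicator hA
  have hindep : iIndepFun (fun i (x : ι → X) => A.indicator (1 : X → ℝ) (x i))
      (Measure.pi fun _ => ν) := iIndepFun_pi fun _ => hind.aemeasurable
  have hbound (x : X) : A.indicator (1 : X → ℝ) x ∈ Set.Icc 0 1 :=
    ⟨Set.indicator_nonneg (by simp) x, Set.indicator_le_self' (by simp) x⟩
  have hmean (i : ι) : ∫ x, A.indicator (1 : X → ℝ) (x i) ∂(Measure.pi fun _ : ι => ν) =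
      ν.real A := by
    rw [integral_comp_eval (μ := fun _ : ι => ν) hind.aestronglyMeasurable,
      integral_indicator_one hA]
  have h := measureReal_le_abs_average_sub_integral hindep
    (fun i => (hind.comp (measurable_pi_apply i)).aemeasurable)
    (fun i => ae_of_all _ fun x => hbound (x i)) hε
  simpa [hmean, empFreq, Finset.sum_sub_distrib, sub_div] using h

theorem pi_deviationSet_le_two_mul_pi_ghostDeviationSet (hF : ∀ A ∈ F, MeasurableSet A) {ε : ℝ}
    (hε : 0 ≤ ε) (hn : 2 * Real.exp (-(Fintype.card ι * ε ^ 2 / 2)) ≤ 1 / 2) :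
    (Measure.pi fun _ => ν).real (deviationSet F ν ε : Set (ι → X)) ≤
      2 * (Measure.pi fun _ => ν).real (ghostDeviationSet F (ε / 2) : Set (ι ⊕ ι → X)) := by
  set μ : Measure (ι → X) := Measure.pi fun _ => ν
  set split := (MeasurableEquiv.sumPiEquivProdPi fun _ : ι ⊕ ι => X).symm
  have hsplit : (μ.prod μ) (split ⁻¹' ghostDeviationSet F (ε / 2)) =
      (Measure.pi fun _ => ν) (ghostDeviationSet F (ε / 2) : Set (ι ⊕ ι → X)) :=
    (measurePreserving_sumPiEquivProdPi_symm fun _ : ι ⊕ ι => ν).measure_preimage_equiv _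
  have hsection : ∀ x ∈ deviationSet F ν ε,
      (2⁻¹ : ENNReal) ≤ μ (Prod.mk x ⁻¹' (split ⁻¹' ghostDeviationSet F (ε / 2))) := by
    rintro x ⟨A, hA, hx⟩
    have hcover : Set.univ ⊆ {y : ι → X | ε / 2 ≤ |empFreq A y - ν.real A|} ∪
        Prod.mk x ⁻¹' (split ⁻¹' ghostDeviationSet F (ε / 2)) := by
      intro y _
      refine or_iff_not_imp_left.2 fun (hy : ¬ε / 2 ≤ |empFreq A y - ν.real A|) => ⟨A, hA, ?_⟩
      have htri := abs_sub_le (empFreq A x) (empFreq A y) (ν.real A)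
      change ε / 2 ≤ |empFreq A x - empFreq A y|
      linarith [not_le.1 hy]
    have hatypical : μ.real {y : ι → X | ε / 2 ≤ |empFreq A y - ν.real A|} ≤ 1 / 2 := by
      refine (pi_le_abs_empFreq_sub_measureReal (hF A hA) (by positivity)).trans (le_trans ?_ hn)
      apply le_of_eq
      ring_nf
    have hone := (measureReal_mono hcover).trans (measureReal_union_le (μ := μ) _ _)
    rw [probReal_univ] at hone
    rw [← ofReal_measureReal, ← ENNReal.ofReal_ofNat, ← ENNReal.ofReal_inv_of_pos two_pos]
    exact ENNReal.ofReal_le_ofReal (by linarith)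
  have h := mul_measure_le_prod_of_forall_le_section μ μ hsection
  rw [hsplit] at h
  have hreal := ENNReal.toReal_mono (measure_ne_top _ _) h
  rw [ENNReal.toReal_mul, ENNReal.toReal_inv, ENNReal.toReal_ofNat] at hreal
  simp only [measureReal_def]
  linarith

theorem one_le_two_mul_exp_mul_pow_div_pow {n d : ℕ} (hd : d ≤ 2 * n) :
    1 ≤ (2 * Real.exp 1 * n) ^ d / (d : ℝ) ^ d := by
  rcases Nat.eq_zero_or_pos d with rfl | hpos
  · simp
  have hd' : (d : ℝ) ≤ 2 * n := by exact_mod_cast hd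
  rw [one_le_div (by positivity)]
  gcongr
  nlinarith [Real.add_one_le_exp 1, (Nat.cast_nonneg n : (0 : ℝ) ≤ n)]

theorem pi_deviationSet_le (hmeas : SampleMeasurable F ν) (hF : ∀ A ∈ F, MeasurableSet A) {d : ℕ}
    (hdim : vcDim F ≤ d) (hd : d ≤ 2 * Fintype.card ι) {ε : ℝ} (hε : 0 ≤ ε) :
    (Measure.pi fun _ => ν).real (deviationSet F ν ε : Set (ι → X)) ≤
      4 * ((2 * Real.exp 1 * Fintype.card ι) ^ d / (d : ℝ) ^ d) *
        Real.exp (-(Fintype.card ι * ε ^ 2 / 8)) := by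
  by_cases hn : 2 * Real.exp (-(Fintype.card ι * ε ^ 2 / 2)) ≤ 1 / 2
  · have hsymm := pi_deviationSet_le_two_mul_pi_ghostDeviationSet (ν := ν) hF hε hn
    have hghost := pi_ghostDeviationSet_le hmeas hdim hd (by positivity : 0 ≤ ε / 2)
    rw [show Fintype.card ι * (ε / 2) ^ 2 / 2 = Fintype.card ι * ε ^ 2 / 8 by ring] at hghost
    linarith
  · -- Samples too small for symmetrization: the right-hand side is at least `1`.
    have hexp : 1 / 4 ≤ Real.exp (-(Fintype.card ι * ε ^ 2 / 8)) := by
      have hmono : Real.exp (-(Fintype.card ι * ε ^ 2 / 2)) ≤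
          Real.exp (-(Fintype.card ι * ε ^ 2 / 8)) := by
        gcongr
        norm_num
      linarith
    calc (Measure.pi fun _ => ν).real (deviationSet F ν ε : Set (ι → X)) ≤ 1 := measureReal_le_one
      _ = 4 * 1 * (1 / 4) := by norm_num
      _ ≤ _ := by
        gcongr
        exact one_le_two_mul_exp_mul_pow_div_pow hd

end VapnikChervonenkis

section Gap

variable {X : Type*} {L : ℕ} {q q' : Fin (L + 1) → Fin (L + 1) → ℝ}

theorem gap_le (q : Fin (L + 1) → Fin (L + 1) → ℝ) {ϑ m : Fin (L + 1)} (h : m ≠ ϑ) :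
    gap q ≤ q ϑ ϑ - q ϑ m :=
  (ciInf_le (Set.finite_range _).bddBelow ϑ).trans
    (ciInf_le (Set.finite_range _).bddBelow (⟨m, h⟩ : {m : Fin (L + 1) // m ≠ ϑ}))

theorem exists_gap_eq (hL : 1 ≤ L) (q : Fin (L + 1) → Fin (L + 1) → ℝ) :
    ∃ ϑ m : Fin (L + 1), m ≠ ϑ ∧ gap q = q ϑ ϑ - q ϑ m := by
  have : Nontrivial (Fin (L + 1)) := Fin.nontrivial_iff_two_le.2 (by lia)
  obtain ⟨ϑ, hϑ⟩ := exists_eq_ciInf_of_finite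
    (f := fun ϑ : Fin (L + 1) => ⨅ m : {m : Fin (L + 1) // m ≠ ϑ}, (q ϑ ϑ - q ϑ m))
  have : Nonempty {m : Fin (L + 1) // m ≠ ϑ} := nonempty_subtype.2 (exists_ne ϑ)
  obtain ⟨m, hm⟩ := exists_eq_ciInf_of_finite
    (f := fun m : {m : Fin (L + 1) // m ≠ ϑ} => q ϑ ϑ - q ϑ m)
  exact ⟨ϑ, m, m.2, (hm.trans hϑ).symm⟩

theorem gap_le_gap_add_of_abs_sub_le (hL : 1 ≤ L) {ε : ℝ} (h : ∀ ϑ m, |q ϑ m - q' ϑ m| ≤ ε) :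
    gap q ≤ gap q' + 2 * ε := by
  obtain ⟨ϑ, m, hm, hgap⟩ := exists_gap_eq hL q'
  have hdiag := (abs_le.1 (h ϑ ϑ)).2
  have hoff := (abs_le.1 (h ϑ m)).1
  linarith [gap_le q hm]

theorem empGapArgmax_nonempty {N : ℕ} {G : Set (X → Fin (L + 1))} (hG : G.Nonempty)
    (t : Fin (L + 1) → Fin N → X) : (empGapArgmax G t).Nonempty := by
  -- The empirical gap only depends on the labels of the finitely many sample points.
  have hfinite : ((fun g => gap (empConf t g)) '' G).Finite := by
    refine (Set.finite_range fun y : Fin (L + 1) → Fin N → Fin (L + 1) =>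
      gap (empConf y id)).subset ?_
    rintro _ ⟨g, -, rfl⟩
    exact ⟨fun ϑ i => g (t ϑ i), rfl⟩
  obtain ⟨_, ⟨g, hg, rfl⟩, hmax⟩ := Set.exists_max_image _ id hfinite (hG.image _)
  exact ⟨g, hg, fun h hh => hmax _ (Set.mem_image_of_mem _ hh)⟩

variable [MeasurableSpace X] {P : Fin (L + 1) → ProbabilityMeasure X}

theorem gap_conf_pos_iff (hL : 1 ≤ L) {g : X → Fin (L + 1)} :
    0 < gap (conf P g) ↔ IsSeparableClassifier P g := by
  refine ⟨fun h ϑ m hm => sub_pos.1 (h.trans_le (gap_le _ hm)), fun h => ?_⟩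
  obtain ⟨ϑ, m, hm, hgap⟩ := exists_gap_eq hL (conf P g)
  exact hgap ▸ sub_pos.2 (h ϑ m hm)

theorem isSeparableClassifier_of_mem_empGapArgmax (hL : 1 ≤ L) {N : ℕ}
    {G : Set (X → Fin (L + 1))} {t : Fin (L + 1) → Fin N → X} {ε : ℝ}
    (hdev : ∀ h ∈ G, ∀ ϑ m, |empConf t h ϑ m - conf P h ϑ m| ≤ ε) {gstar g : X → Fin (L + 1)}
    (hstar : gstar ∈ G) (hε : 4 * ε < gap (conf P gstar)) (hg : g ∈ empGapArgmax G t) :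
    IsSeparableClassifier P g := by
  refine (gap_conf_pos_iff hL).1 ?_
  have hstar_le := gap_le_gap_add_of_abs_sub_le hL fun ϑ m =>
    (abs_sub_comm _ _).trans_le (hdev gstar hstar ϑ m)
  have hg_le := gap_le_gap_add_of_abs_sub_le hL (hdev g hg.1)
  linarith [hg.2 gstar hstar]

end Gap

section TrainingData

variable {X : Type*} {L : ℕ}

theorem empConf_eq_empFreq {N : ℕ} (t : Fin (L + 1) → Fin N → X) (g : X → Fin (L + 1))
    (ϑ m : Fin (L + 1)) : empConf t g ϑ m = empFreq {x | g x = m} (t ϑ) := by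
  classical
  simp [empConf, empFreq, Set.indicator_apply, div_eq_inv_mul]

theorem mul_exp_neg_le_of_mul_log_div_le {M γ δ n : ℝ} (hγ : γ ≠ 0) (hδ : 0 < δ)
    (hn : 8 / γ ^ 2 * Real.log (M / δ) ≤ n) : M * Real.exp (-(n * γ ^ 2 / 8)) ≤ δ := by
  have hlog : Real.log (M / δ) ≤ n * γ ^ 2 / 8 := by
    have hγ' : 0 < γ ^ 2 := by positivity
    rw [div_mul_eq_mul_div, div_le_iff₀ hγ'] at hn
    linarith
  rw [Real.exp_neg, ← div_eq_mul_inv, div_le_comm₀ (Real.exp_pos _) hδ]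
  exact (Real.le_exp_log _).trans (Real.exp_le_exp.2 hlog)

variable {Ω : Type*} [MeasurableSpace X] [MeasurableSpace Ω] {μ : Measure Ω}

theorem measureReal_preimage_le_of_hasLaw {Y : Ω → X} {ν : Measure X} [IsFiniteMeasure ν]
    (hY : HasLaw Y ν μ) (s : Set X) : μ.real (Y ⁻¹' s) ≤ ν.real s := by
  refine ENNReal.toReal_mono (measure_ne_top ν s) ?_
  rw [← hY.map_eq]
  exact Measure.le_map_apply hY.aemeasurable s

theorem measurableSet_of_mem_labelClass {G : Set (X → Fin (L + 1))} (hG : ∀ g ∈ G, Measurable g)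
    {m : Fin (L + 1)} {A : Set X} (hA : A ∈ labelClass G m) : MeasurableSet A := by
  obtain ⟨g, hg, rfl⟩ := hA
  exact hG g hg (measurableSet_singleton m)

theorem measureReal_exists_mem_deviationSet_le {N d : ℕ} {G : Set (X → Fin (L + 1))}
    (hG : ∀ g ∈ G, Measurable g) {P : Fin (L + 1) → ProbabilityMeasure X}
    (hmeas : ∀ ϑ m, SampleMeasurable (labelClass G m) (P ϑ : Measure X))
    (hdim : ∀ m, vcDim (labelClass G m) ≤ d) (hd : d ≤ 2 * N) {ε : ℝ} (hε : 0 ≤ ε)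
    {T : Fin (L + 1) → Fin N → Ω → X} (hlaw : ∀ ϑ i, HasLaw (T ϑ i) (P ϑ : Measure X) μ)
    (hindep : ∀ ϑ, iIndepFun (T ϑ) μ) :
    μ.real {ω | ∃ ϑ m, (fun i => T ϑ i ω) ∈ deviationSet (labelClass G m) (P ϑ : Measure X) ε} ≤
      ((L : ℝ) + 1) ^ 2 * 4 * ((2 * Real.exp 1 * N) ^ d / (d : ℝ) ^ d) *
        Real.exp (-(N * ε ^ 2 / 8)) := by
  have hpair (ϑ m : Fin (L + 1)) :
      μ.real {ω | (fun i => T ϑ i ω) ∈ deviationSet (labelClass G m) (P ϑ : Measure X) ε} ≤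
        4 * ((2 * Real.exp 1 * N) ^ d / (d : ℝ) ^ d) * Real.exp (-(N * ε ^ 2 / 8)) := by
    have hVC := pi_deviationSet_le (ι := Fin N) (hmeas ϑ m)
      (fun A => measurableSet_of_mem_labelClass hG) (hdim m) (by simpa using hd) hε
    rw [Fintype.card_fin] at hVC
    exact (measureReal_preimage_le_of_hasLaw ((hindep ϑ).hasLaw_pi (hlaw ϑ)) _).trans hVC
  simp only [Set.ofPred_exists]
  calc _ ≤ ∑ ϑ, ∑ m, μ.real
        {ω | (fun i => T ϑ i ω) ∈ deviationSet (labelClass G m) (P ϑ : Measure X) ε} :=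
        (measureReal_iUnion_fintype_le _).trans
          (Finset.sum_le_sum fun ϑ _ => measureReal_iUnion_fintype_le _)
    _ ≤ ∑ _ : Fin (L + 1), ∑ _ : Fin (L + 1),
        4 * ((2 * Real.exp 1 * N) ^ d / (d : ℝ) ^ d) * Real.exp (-(N * ε ^ 2 / 8)) :=
        Finset.sum_le_sum fun ϑ _ => Finset.sum_le_sum fun m _ => hpair ϑ m
    _ = _ := by
        simp only [Finset.sum_const, Finset.card_univ, Fintype.card_fin, nsmul_eq_mul]
        push_cast
        ring

theorem abs_empConf_sub_conf_lt_of_notMem_deviationSet {N : ℕ} {G : Set (X → Fin (L + 1))}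
    {P : Fin (L + 1) → ProbabilityMeasure X} {t : Fin (L + 1) → Fin N → X} {ε : ℝ}
    {ϑ m : Fin (L + 1)} (ht : t ϑ ∉ deviationSet (labelClass G m) (P ϑ : Measure X) ε)
    {g : X → Fin (L + 1)} (hg : g ∈ G) : |empConf t g ϑ m - conf P g ϑ m| < ε := by
  rw [empConf_eq_empFreq]
  exact not_le.1 fun h => ht ⟨_, ⟨g, hg, rfl⟩, h⟩

end TrainingData

end EmpSep

theorem mainTheorem4 {X : Type*} [MeasurableSpace X] (L : ℕ) (hL : 1 ≤ L)
    -- the hypothesis class of measurable classifiers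
    (G : Set (X → Fin (L + 1))) (hG : ∀ g ∈ G, Measurable g)
    (P : Fin (L + 1) → ProbabilityMeasure X) (hP : P ∈ EmpSep.Psep G)
    (hmeas : ∀ ϑ m : Fin (L + 1),
      EmpSep.SampleMeasurable (EmpSep.labelClass G m) (P ϑ : Measure X))
    (d : ℕ) (hd : ∀ m : Fin (L + 1), EmpSep.vcDim (EmpSep.labelClass G m) ≤ (d : ℕ∞)) :
    (∃ gstar ∈ G, 0 < EmpSep.gap (EmpSep.conf P gstar)) ∧
    ∀ gstar ∈ G, 0 < EmpSep.gap (EmpSep.conf P gstar) →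
      ∀ γ : ℝ, γ = EmpSep.gap (EmpSep.conf P gstar) / 8 →
      ∀ δ : ℝ, 0 < δ → δ < 1 →
      ∀ N : ℕ,
        max (d : ℝ) (8 / γ ^ 2 *
          Real.log (((L : ℝ) + 1) ^ 2 * 4 * ((2 * Real.exp 1 * N) ^ d / (d : ℝ) ^ d) / δ)) ≤ N →
      -- the training data: for each label `ϑ`, an i.i.d. sample of size `N` from `P ϑ`
      ∀ {Ω : Type*} [MeasurableSpace Ω] (μ : Measure Ω) [IsProbabilityMeasure μ]
        (T : Fin (L + 1) → Fin N → Ω → X),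
        (∀ ϑ i, HasLaw (T ϑ i) (P ϑ : Measure X) μ) →
        (∀ ϑ, iIndepFun (T ϑ) μ) →
        -- empirical-gap maximizers exist, and with probability at least `1 - δ` all are separable
        (∀ ω, (EmpSep.empGapArgmax G fun ϑ i => T ϑ i ω).Nonempty) ∧
        ∃ E : Set Ω, MeasurableSet E ∧ 1 - δ ≤ μ.real E ∧
          ∀ ω ∈ E, ∀ ghat ∈ EmpSep.empGapArgmax G (fun ϑ i => T ϑ i ω),
            EmpSep.IsSeparableClassifier P ghat := by
  obtain ⟨g₀, hg₀, hsep⟩ := hP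
  refine ⟨⟨g₀, hg₀, (EmpSep.gap_conf_pos_iff hL).2 hsep⟩, ?_⟩
  rintro gstar hstar hgap γ rfl δ hδ - N hN Ω _ μ _ T hlaw hindep
  refine ⟨fun ω => EmpSep.empGapArgmax_nonempty ⟨g₀, hg₀⟩ _, ?_⟩
  obtain ⟨hdN, hlogN⟩ := max_le_iff.1 hN
  set γ := EmpSep.gap (EmpSep.conf P gstar) / 8
  have hγ : 0 < γ := by positivity
  have hd2N : d ≤ 2 * N := by
    have : d ≤ N := by exact_mod_cast hdN
    lia
  have hunlikely := (EmpSep.measureReal_exists_mem_deviationSet_le hG hmeas hd hd2N hγ.le hlaw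
    hindep).trans (EmpSep.mul_exp_neg_le_of_mul_log_div_le hγ.ne' hδ hlogN)
  obtain ⟨E, hE, hδE, hdisj⟩ := EmpSep.exists_measurableSet_one_sub_le_measureReal hunlikely
  refine ⟨E, hE, hδE, fun ω hω ghat hghat => ?_⟩
  have haccurate (h) (hh : h ∈ G) (ϑ m : Fin (L + 1)) :
      |EmpSep.empConf (fun ϑ i => T ϑ i ω) h ϑ m - EmpSep.conf P h ϑ m| ≤ γ :=
    (EmpSep.abs_empConf_sub_conf_lt_of_notMem_deviationSet
      (fun hmem => Set.disjoint_left.1 hdisj hω ⟨ϑ, m, hmem⟩) hh).le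
  exact EmpSep.isSeparableClassifier_of_mem_empGapArgmax hL haccurate hstar
    (by simp only [γ]; linarith) hghat
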